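/- For data points $x_1,\dots,x_n\in\mathbb R^d$ let $q=\frac1n\sum_{i=1}^n\delta_{x_i}$, and call the data normalized if $\frac1n\sum_i x_i=0$ and $\frac1{dn}\sum_i\|x_i\|^2=1$. Let $\mathcal A$ be the set of pairs $(a,m)$ of functions $[0,1]\to[0,\infty)$, continuous on $[0,1]$ and smooth on $(0,1)$, with $a_0=0=m_1$ and $a_1=1=m_0$. For $M\ge 1$ let $\mathcal A_M$ be the set of $(a,m)\in\mathcal A$ such that $a_t/m_t$ is strictly increasing (with value $\infty$ at $t=1$) and $\|a\|_{1,\infty},\|m\|_{1,\infty}\le M$, where $\|f\|_{1,\infty}=\max\{\sup_{[0,1]}|f|,\ \sup_{(0,1)}|\dot f|\}$. For $(a,m)\in\mathcal A_M$ and $t\in(0,1)$ define $p_t(x|x_1)=\mathcal N(x\,|\,a_tx_1,m_t^2I)$, $p_t(x)=\int p_t(x|x_1)\,q(dx_1)$, $$u_t(x|x_1)=\frac{\dot m_t}{m_t}x+\Big(\dot a_t-a_t\frac{\dot m_t}{m_t}\Big)x_1,\qquad u_t(x)=\int u_t(x|x_1)\frac{p_t(x|x_1)}{p_t(x)}\,q(dx_1),$$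 and the kinetic energy $\mathcal E_q(a,m)=\frac1d\int_0^1\int_{\mathbb R^d}\|u_t(x)\|^2p_t(x)\,dx\,dt$. Then the Cond-OT conditional $a_t=t$, $m_t=1-t$ belongs to $\mathcal A_M$ and is asymptotically kinetic optimal in $\mathcal A_M$ as $n/\sqrt d\to0$, uniformly over the data: for every $M\ge1$ and $\varepsilon>0$ there is $\delta>0$ such that for all $n,d$ with $n/\sqrt d<\delta$ and all normalized data $x_1,\dots,x_n\in\mathbb R^d$, the energy $\mathcal E_q(t,1-t)$ is finite and $$\mathcal E_q(t,1-t)\ \le\ \inf_{(a,m)\in\mathcal A_M}\mathcal E_q(a,m)+\varepsilon .$$ -/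

import Mathlib

open MeasureTheory
open scoped ENNReal ContDiff

noncomputable section

/-- `ℝ^d` with the Euclidean norm. -/
abbrev Space (d : ℕ) : Type := EuclideanSpace ℝ (Fin d)

/-- The density at `x` of the isotropic Gaussian `𝒩(μ, σ² I)` on `ℝ^d`. -/
def gaussianDensity {d : ℕ} (μ : Space d) (σ : ℝ) (x : Space d) : ℝ :=
  (2 * Real.pi * σ ^ 2) ^ (-(d : ℝ) / 2) * Real.exp (-‖x - μ‖ ^ 2 / (2 * σ ^ 2))

/-- The conditional density `p_t(x | x₁) = 𝒩(x | a_t x₁, m_t² I)`. -/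
def condDensity {d : ℕ} (a m : ℝ → ℝ) (t : ℝ) (x₁ x : Space d) : ℝ :=
  gaussianDensity (a t • x₁) (m t) x

/-- The marginal density `p_t(x) = ∫ p_t(x | x₁) q(dx₁)`. -/
def pathDensity {d : ℕ} (q : Measure (Space d)) (a m : ℝ → ℝ) (t : ℝ) (x : Space d) : ℝ :=
  ∫ x₁, condDensity a m t x₁ x ∂q

/-- The conditional vector field `u_t(x | x₁) = α_t x + β_t x₁` with `α_t = m_t' / m_t` and
`β_t = a_t' - a_t m_t' / m_t`. -/
def condField {d : ℕ} (a m : ℝ → ℝ) (t : ℝ) (x₁ x : Space d) : Space d :=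
  (deriv m t / m t) • x + (deriv a t - a t * (deriv m t / m t)) • x₁

/-- The marginal vector field `u_t(x) = ∫ u_t(x | x₁) p_t(x | x₁) / p_t(x) q(dx₁)`. -/
def pathField {d : ℕ} (q : Measure (Space d)) (a m : ℝ → ℝ) (t : ℝ) (x : Space d) : Space d :=
  ∫ x₁, (condDensity a m t x₁ x / pathDensity q a m t x) • condField a m t x₁ x ∂q

/-- The kinetic energy `(1/d) 𝔼_{t, p_t(x)} ‖u_t(x)‖²`, with `t` uniform on `(0,1)`, as an extended
nonnegative number. -/
def kineticEnergy {d : ℕ} (q : Measure (Space d)) (a m : ℝ → ℝ) : ℝ≥0∞ :=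
  (d : ℝ≥0∞)⁻¹ * ∫⁻ t in Set.Ioo (0 : ℝ) 1, ∫⁻ x : Space d,
    ENNReal.ofReal (‖pathField q a m t x‖ ^ 2 * pathDensity q a m t x)

/-- The pairs `(a, m)` of nonnegative functions on `[0,1]`, continuous on `[0,1]` and smooth on
`(0,1)`, with `a_0 = 0 = m_1` and `a_1 = 1 = m_0`. Values outside `[0,1]` are irrelevant. -/
structure IsAffineConditional (a m : ℝ → ℝ) : Prop where
  a_nonneg : ∀ t ∈ Set.Icc (0 : ℝ) 1, 0 ≤ a t
  m_nonneg : ∀ t ∈ Set.Icc (0 : ℝ) 1, 0 ≤ m t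
  a_zero : a 0 = 0
  m_one : m 1 = 0
  a_one : a 1 = 1
  m_zero : m 0 = 1
  a_cont : ContinuousOn a (Set.Icc 0 1)
  m_cont : ContinuousOn m (Set.Icc 0 1)
  a_smooth : ContDiffOn ℝ ∞ a (Set.Ioo 0 1)
  m_smooth : ContDiffOn ℝ ∞ m (Set.Ioo 0 1)

/-- `‖f‖_{W^{1,∞}([0,1])} ≤ M` for `f` continuous on `[0,1]` and smooth on `(0,1)`. -/
def SobolevBound (f : ℝ → ℝ) (M : ℝ) : Prop :=
  (∀ t ∈ Set.Icc (0 : ℝ) 1, |f t| ≤ M) ∧ ∀ t ∈ Set.Ioo (0 : ℝ) 1, |deriv f t| ≤ M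

/-- The affine conditionals `(a, m)` with `a / m` strictly increasing and with `W^{1,∞}` norms
bounded by `M`. At `t = 1` the ratio is `1 / 0 = ∞`, so strict monotonicity on `[0,1]` amounts to
finiteness and strict monotonicity on `[0,1)`. In Lean a quotient by `0` is `0`, the value at
`t = 0`; so strict monotonicity on `[0,1)` already forces `m ≠ 0` there. -/
def conditionalFamily (M : ℝ) : Set ((ℝ → ℝ) × (ℝ → ℝ)) :=
  {c | IsAffineConditional c.1 c.2 ∧
    StrictMonoOn (fun t => c.1 t / c.2 t) (Set.Ico 0 1) ∧
    SobolevBound c.1 M ∧ SobolevBound c.2 M}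

/-- The Cond-OT conditional `a_t = t`, `m_t = 1 - t`. -/
def condOT : (ℝ → ℝ) × (ℝ → ℝ) := (fun t => t, fun t => 1 - t)

/-- The data distribution giving mass `1/n` to each of the points `x_1, …, x_n`. -/
def dataMeasure {n d : ℕ} (x : Fin n → Space d) : Measure (Space d) :=
  (n : ℝ≥0∞)⁻¹ • ∑ i, Measure.dirac (x i)

/-- The data are normalized: `(1/n) ∑ x_i = 0` and `(1/(dn)) ∑ ‖x_i‖² = 1`. The second equation
forces `n ≠ 0` and `d ≠ 0`. -/
def IsNormalizedData {n d : ℕ} (x : Fin n → Space d) : Prop :=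
  (1 / (n : ℝ)) • ∑ i, x i = 0 ∧ 1 / ((d : ℝ) * n) * ∑ i, ‖x i‖ ^ 2 = 1

end

/-!
Write `u` for the marginal field and `u_i`, `φ_i` for the conditional field and density of the data
point `x_i`. At each `y`, `u(y)` is the mean of the `u_i(y)` under the posterior weights
`φ_i / ∑ φ_k`, so `‖u‖² p` is the mean of `φ_i ‖u_i‖²` over the data minus a posterior variance
(`sum_mul_norm_sq_mean_add`). For normalized data the mean integrates over space to
`d (a'² + m'²)`. Over time this is at least `2 d` for every admissible pair, as
`∫ a' = 1 = -∫ m'`, and it equals `2 d` for Cond-OT. Hence the energy of Cond-OT is at most `2`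
(`kineticEnergy_condOT_le`), and it remains to show that the posterior variance is negligible for
every competitor (`two_le_kineticEnergy_add`).

Differences of conditional fields are `u_i - u_j = β (x_i - x_j)`, and the product of two posterior
weights with `p` is at most `√(φ_i φ_j) / n`. The overlap `∫ √(φ_i φ_j)` of two Gaussians is
`exp (-r² ‖x_i - x_j‖² / 8)` with `r = a / m` (`lintegral_sqrt_gaussianDensity_mul`), so two distinct
points contribute only while `r` is of order `1 / ‖x_i - x_j‖`. Now `β = m r'`, and
`m² r' = a' m - a m'` is at most `2 M²`, so that `β² ≤ 2 M² |r'|` (`sq_condField_coeff_le`). Since `r` is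
injective, it can be taken as the variable of integration, and the pair `(i, j)` contributes at most
a constant times `M² ‖x_i - x_j‖ / n` (`lintegral_deriv_ratio_mul_le`,
`lintegral_sq_mul_exp_neg_sq`). By Cauchy-Schwarz `∑ ‖x_i - x_j‖ ≤ √2 n² √d`; after division by `d`
the total variance is at most `8 M² n / √d`, uniformly over the data and the competitors.
-/

/-! ### Weighted means in inner product spaces -/

section WeightedMean
open scoped RealInnerProductSpace
variable {n : ℕ} {E : Type*} [NormedAddCommGroup E] [InnerProductSpace ℝ E]

/-- The second moment of weights of total mass `1` is the square of the mean plus the variance,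
the latter written through pairwise differences. -/
theorem norm_sq_weighted_sum_add (w : Fin n → ℝ) (hw : ∑ i, w i = 1) (v : Fin n → E) :
    ‖∑ i, w i • v i‖ ^ 2 + 1 / 2 * ∑ i, ∑ j, w i * w j * ‖v i - v j‖ ^ 2 =
      ∑ i, w i * ‖v i‖ ^ 2 := by
  have h1 : ‖∑ i, w i • v i‖ ^ 2 = ∑ i, ∑ j, w i * w j * ⟪v i, v j⟫ := by
    rw [← real_inner_self_eq_norm_sq, sum_inner]
    refine Finset.sum_congr rfl fun i _ => ?_
    rw [inner_sum]
    refine Finset.sum_congr rfl fun j _ => ?_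
    rw [real_inner_smul_left, real_inner_smul_right, mul_assoc]
  have h2 : ∑ i, ∑ j, w i * w j * ‖v i - v j‖ ^ 2 =
      ∑ i, ∑ j, (w j * (w i * ‖v i‖ ^ 2) + w i * (w j * ‖v j‖ ^ 2)
        - 2 * (w i * w j * ⟪v i, v j⟫)) := by
    refine Finset.sum_congr rfl fun i _ => Finset.sum_congr rfl fun j _ => ?_
    rw [norm_sub_sq_real]; ring
  rw [h1, h2]
  simp only [Finset.sum_sub_distrib, Finset.sum_add_distrib, ← Finset.mul_sum, ← Finset.sum_mul, hw]
  ring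

/-- Cauchy-Schwarz over all pairs, together with the bound `2 n ∑ ‖v i‖²` on the sum of the squared
distances. -/
theorem sum_sum_norm_sub_le (v : Fin n → E) :
    ∑ i, ∑ j, ‖v i - v j‖ ≤ n * √(2 * n * ∑ i, ‖v i‖ ^ 2) := by
  rcases Nat.eq_zero_or_pos n with rfl | hn
  · simp
  have hn' : (0 : ℝ) < n := by exact_mod_cast hn
  have hD : ∑ i, ∑ j, ‖v i - v j‖ ^ 2 ≤ 2 * n * ∑ i, ‖v i‖ ^ 2 := by
    -- The squared distances are controlled by the variance decomposition with equal weights.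
    have h := norm_sq_weighted_sum_add (fun _ : Fin n => (n : ℝ)⁻¹)
      (by simp [hn'.ne']) v
    simp only [← Finset.mul_sum] at h
    have h0 := sq_nonneg ‖∑ i, (n : ℝ)⁻¹ • v i‖
    have h3 : 1 / 2 * ((n : ℝ)⁻¹ * (n : ℝ)⁻¹ * ∑ i, ∑ j, ‖v i - v j‖ ^ 2) ≤
        (n : ℝ)⁻¹ * ∑ i, ‖v i‖ ^ 2 := by linarith
    have h4 := mul_le_mul_of_nonneg_left h3 (by positivity : (0 : ℝ) ≤ 2 * n ^ 2)
    field_simp at h4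
    linarith
  have hCS : (∑ i, ∑ j, ‖v i - v j‖) ^ 2 ≤ (n * n : ℝ) * ∑ i, ∑ j, ‖v i - v j‖ ^ 2 := by
    have := sq_sum_le_card_mul_sum_sq (s := (Finset.univ : Finset (Fin n × Fin n)))
      (f := fun p => ‖v p.1 - v p.2‖)
    simpa [Fintype.sum_prod_type] using this
  refine le_of_sq_le_sq ?_ (by positivity)
  rw [mul_pow, Real.sq_sqrt (by positivity)]
  nlinarith [mul_le_mul_of_nonneg_left hD (by positivity : (0 : ℝ) ≤ n * n)]

/-- The variance decomposition for weights that are normalized by their sum. -/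
theorem sum_mul_norm_sq_mean_add {φ : Fin n → ℝ} (hS : 0 < ∑ i, φ i) (v : Fin n → E) :
    (∑ i, φ i) * ‖∑ i, (φ i / ∑ k, φ k) • v i‖ ^ 2 +
      1 / 2 * ∑ i, ∑ j, φ i * φ j / (∑ k, φ k) * ‖v i - v j‖ ^ 2 = ∑ i, φ i * ‖v i‖ ^ 2 := by
  set S := ∑ k, φ k
  have h := norm_sq_weighted_sum_add (fun i => φ i / S)
    (by rw [← Finset.sum_div, div_self hS.ne']) v
  have e1 : ∑ i, ∑ j, φ i * φ j / S * ‖v i - v j‖ ^ 2 =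
      S * ∑ i, ∑ j, φ i / S * (φ j / S) * ‖v i - v j‖ ^ 2 := by
    simp only [Finset.mul_sum]
    refine Finset.sum_congr rfl fun i _ => Finset.sum_congr rfl fun j _ => ?_
    field_simp
  have e2 : ∑ i, φ i * ‖v i‖ ^ 2 = S * ∑ i, φ i / S * ‖v i‖ ^ 2 := by
    simp only [Finset.mul_sum]
    refine Finset.sum_congr rfl fun i _ => ?_
    field_simp
  rw [e1, e2, ← h]; ring

theorem sum_mul_norm_sq_mean_le {φ : Fin n → ℝ} (hφ : ∀ i, 0 < φ i) (hS : 0 < ∑ i, φ i)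
    (v : Fin n → E) :
    (∑ i, φ i) * ‖∑ i, (φ i / ∑ k, φ k) • v i‖ ^ 2 ≤ ∑ i, φ i * ‖v i‖ ^ 2 := by
  rw [← sum_mul_norm_sq_mean_add hS v]
  have : 0 ≤ ∑ i, ∑ j, φ i * φ j / (∑ k, φ k) * ‖v i - v j‖ ^ 2 :=
    Finset.sum_nonneg fun i _ => Finset.sum_nonneg fun j _ =>
      mul_nonneg (div_nonneg (mul_pos (hφ i) (hφ j)).le hS.le) (sq_nonneg _)
  linarith

/-- The variance about the weighted mean is at most a sum over pairs, weighted by the geometric means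
`√(φ i * φ j)`; these replace `φ i * φ j / ∑ φ`, which has no closed-form integral for Gaussians. -/
theorem le_sum_mul_norm_sq_mean_add {φ : Fin n → ℝ} (hφ : ∀ i, 0 < φ i) (hS : 0 < ∑ i, φ i)
    (v : Fin n → E) :
    ∑ i, φ i * ‖v i‖ ^ 2 ≤ (∑ i, φ i) * ‖∑ i, (φ i / ∑ k, φ k) • v i‖ ^ 2 +
      1 / 2 * ∑ i, ∑ j, √(φ i * φ j) * ‖v i - v j‖ ^ 2 := by
  rw [← sum_mul_norm_sq_mean_add hS v]
  gcongr with i _ j _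
  rw [div_le_iff₀ hS]
  have hle : ∀ i, φ i ≤ ∑ k, φ k := fun i =>
    Finset.single_le_sum (fun k _ => (hφ k).le) (Finset.mem_univ i)
  have hsq : √(φ i * φ j) ≤ ∑ k, φ k := by
    rw [Real.sqrt_le_left hS.le, sq]
    exact mul_le_mul (hle i) (hle j) (hφ j).le hS.le
  calc φ i * φ j = √(φ i * φ j) * √(φ i * φ j) :=
        (Real.mul_self_sqrt (mul_pos (hφ i) (hφ j)).le).symm
    _ ≤ _ := by gcongr

end WeightedMean

/-! ### Integrals of isotropic Gaussian densities -/

section Gaussian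
variable {d : ℕ}

theorem gaussianDensity_pos (μ : Space d) {σ : ℝ} (hσ : 0 < σ) (x : Space d) :
    0 < gaussianDensity μ σ x := by
  unfold gaussianDensity; positivity

theorem continuous_gaussianDensity (μ : Space d) (σ : ℝ) : Continuous (gaussianDensity μ σ) := by
  unfold gaussianDensity; fun_prop

/-- By the parallelogram law, the geometric mean of two Gaussian densities of equal variance is a
multiple of the Gaussian density centred at the midpoint. -/
theorem sqrt_gaussianDensity_mul (μ ν : Space d) {σ : ℝ} (hσ : 0 < σ) (x : Space d) :
    √(gaussianDensity μ σ x * gaussianDensity ν σ x) =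
      Real.exp (-‖μ - ν‖ ^ 2 / (8 * σ ^ 2)) * gaussianDensity (midpoint ℝ μ ν) σ x := by
  rw [Real.sqrt_eq_iff_mul_self_eq_of_pos
    (mul_pos (Real.exp_pos _) (gaussianDensity_pos _ hσ _))]
  have key : ‖x - μ‖ ^ 2 + ‖x - ν‖ ^ 2 =
      2 * ‖x - midpoint ℝ μ ν‖ ^ 2 + ‖μ - ν‖ ^ 2 / 2 := by
    have h := parallelogram_law_with_norm ℝ (x - μ) (x - ν)
    have e1 : x - μ + (x - ν) = (2 : ℝ) • (x - midpoint ℝ μ ν) := by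
      rw [midpoint_eq_smul_add, smul_sub, smul_smul, two_smul]; norm_num; abel
    have e2 : x - μ - (x - ν) = -(μ - ν) := by abel
    rw [e1, e2, norm_neg, norm_smul] at h
    norm_num at h
    nlinarith
  unfold gaussianDensity
  set c := (2 * Real.pi * σ ^ 2) ^ (-(d : ℝ) / 2)
  have : ∀ p q r : ℝ, Real.exp r * (c * Real.exp p) * (Real.exp r * (c * Real.exp p)) =
     c * c * Real.exp (r + r + p + p) := by
    intro p q r; simp only [Real.exp_add]; ring
  rw [this _ 0, mul_mul_mul_comm, ← Real.exp_add]
  congr 2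
  field_simp
  linarith

theorem gaussianDensity_eq (μ : Space d) (σ : ℝ) (x : Space d) :
    gaussianDensity μ σ x =
      (2 * Real.pi * σ ^ 2) ^ (-(d : ℝ) / 2) * Real.exp (-(1 / (2 * σ ^ 2)) * ‖x - μ‖ ^ 2) := by
  rw [gaussianDensity]; congr 2; ring

theorem integral_gaussianDensity (μ : Space d) {σ : ℝ} (hσ : 0 < σ) :
    ∫ x, gaussianDensity μ σ x = 1 := by
  simp_rw [gaussianDensity_eq]
  rw [integral_const_mul,
    integral_sub_right_eq_self (fun z : Space d => Real.exp (-(1 / (2 * σ ^ 2)) * ‖z‖ ^ 2)),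
    GaussianFourier.integral_rexp_neg_mul_sq_norm (by positivity)]
  have : Real.pi / (1 / (2 * σ ^ 2)) = 2 * Real.pi * σ ^ 2 := by field_simp
  rw [this, finrank_euclideanSpace_fin, ← Real.rpow_add (by positivity)]
  norm_num [neg_div]

theorem lintegral_gaussianDensity (μ : Space d) {σ : ℝ} (hσ : 0 < σ) :
    ∫⁻ x, ENNReal.ofReal (gaussianDensity μ σ x) = 1 := by
  have h := integral_gaussianDensity μ hσ
  rw [← ofReal_integral_eq_lintegral_ofReal (.of_integral_ne_zero (by simp [h]))
    (.of_forall fun x => (gaussianDensity_pos μ hσ x).le), h, ENNReal.ofReal_one]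

/-- The second moment of an unnormalized Gaussian. In polar coordinates both integrals are values of
the Gamma function, whose recurrence gives the factor `d / (2 * b)`. -/
theorem integral_norm_sq_mul_exp (hd : d ≠ 0) {b : ℝ} (hb : 0 < b) :
    ∫ z : Space d, ‖z‖ ^ 2 * Real.exp (-b * ‖z‖ ^ 2) =
      d / (2 * b) * ∫ z : Space d, Real.exp (-b * ‖z‖ ^ 2) := by
  have : Nonempty (Fin d) := ⟨⟨0, Nat.pos_of_ne_zero hd⟩⟩
  have key : ∫ y in Set.Ioi (0 : ℝ), y ^ (d - 1) • (y ^ 2 * Real.exp (-b * y ^ 2)) =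
      d / (2 * b) * ∫ y in Set.Ioi (0 : ℝ), y ^ (d - 1) • Real.exp (-b * y ^ 2) := by
    have hd0 : (0 : ℝ) < d := by exact_mod_cast Nat.pos_of_ne_zero hd
    -- `d - 1` is a truncated subtraction in the polar-coordinate formula.
    have hd1 : ((d - 1 : ℕ) : ℝ) = d - 1 := by
      rw [Nat.cast_sub (Nat.pos_of_ne_zero hd)]; simp
    have e1 := integral_rpow_mul_exp_neg_mul_rpow (p := 2) (q := d + 1) (b := b) two_pos
      (by linarith) hb
    have e2 := integral_rpow_mul_exp_neg_mul_rpow (p := 2) (q := d - 1) (b := b) two_pos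
      (by linarith) hb
    have c1 : ∫ y in Set.Ioi (0 : ℝ), y ^ (d - 1) • (y ^ 2 * Real.exp (-b * y ^ 2)) =
        ∫ y in Set.Ioi (0 : ℝ), y ^ ((d : ℝ) + 1) * Real.exp (-b * y ^ (2 : ℝ)) := by
      refine setIntegral_congr_fun measurableSet_Ioi fun y hy => ?_
      have : (y : ℝ) ^ ((d : ℝ) + 1) = y ^ (d - 1) * y ^ 2 := by
        rw [← pow_add, ← Real.rpow_natCast]; congr 1; push_cast; rw [hd1]; ring
      simp only [smul_eq_mul, this, Real.rpow_ofNat]; ring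
    have c2 : ∫ y in Set.Ioi (0 : ℝ), y ^ (d - 1) • Real.exp (-b * y ^ 2) =
        ∫ y in Set.Ioi (0 : ℝ), y ^ ((d : ℝ) - 1) * Real.exp (-b * y ^ (2 : ℝ)) := by
      refine setIntegral_congr_fun measurableSet_Ioi fun y hy => ?_
      simp only [smul_eq_mul, ← hd1, Real.rpow_natCast, Real.rpow_ofNat]
    rw [c1, c2, e1, e2]
    have g1 : ((d : ℝ) + 1 + 1) / 2 = d / 2 + 1 := by ring
    have g2 : ((d : ℝ) - 1 + 1) / 2 = d / 2 := by ring
    have g3 : -((d : ℝ) + 1 + 1) / 2 = -(d / 2) + -1 := by ring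
    have g4 : -((d : ℝ) - 1 + 1) / 2 = -(d / 2) := by ring
    rw [g1, g2, g3, g4, Real.Gamma_add_one (by positivity), Real.rpow_add hb, Real.rpow_neg_one]
    field_simp
  rw [integral_fun_norm_addHaar volume (fun y => y ^ 2 * Real.exp (-b * y ^ 2)),
    integral_fun_norm_addHaar volume (fun y => Real.exp (-b * y ^ 2)), finrank_euclideanSpace_fin,
    key]
  simp only [smul_eq_mul, nsmul_eq_mul]; ring

theorem lintegral_norm_sq_mul_gaussianDensity (hd : d ≠ 0) (μ : Space d) {σ : ℝ} (hσ : 0 < σ) :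
    ∫⁻ x, ENNReal.ofReal (‖x - μ‖ ^ 2 * gaussianDensity μ σ x) = ENNReal.ofReal (d * σ ^ 2) := by
  have hd0 : (0 : ℝ) < d := by exact_mod_cast Nat.pos_of_ne_zero hd
  have h : ∫ x, ‖x - μ‖ ^ 2 * gaussianDensity μ σ x = d * σ ^ 2 := by
    have h1 := integral_gaussianDensity μ hσ
    simp_rw [gaussianDensity_eq, mul_left_comm _ ((2 * Real.pi * σ ^ 2) ^ (-(d : ℝ) / 2))] at h1 ⊢
    rw [integral_const_mul, integral_sub_right_eq_self (fun z : Space d =>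
      Real.exp (-(1 / (2 * σ ^ 2)) * ‖z‖ ^ 2))] at h1
    rw [integral_const_mul, integral_sub_right_eq_self (fun z : Space d =>
      ‖z‖ ^ 2 * Real.exp (-(1 / (2 * σ ^ 2)) * ‖z‖ ^ 2)),
      integral_norm_sq_mul_exp hd (by positivity), mul_left_comm, h1]
    field_simp
  rw [← ofReal_integral_eq_lintegral_ofReal (.of_integral_ne_zero (by rw [h]; positivity))
    (.of_forall fun x => mul_nonneg (sq_nonneg _) (gaussianDensity_pos μ hσ x).le), h]

/-- The second moment of an affine image of a Gaussian vector. -/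
theorem lintegral_gaussianDensity_mul_norm_sq (hd : d ≠ 0) (μ w : Space d) (c : ℝ) {σ : ℝ}
    (hσ : 0 < σ) :
    ∫⁻ x, ENNReal.ofReal (gaussianDensity μ σ x * ‖c • (x - μ) + w‖ ^ 2) =
      ENNReal.ofReal (c ^ 2 * (d * σ ^ 2) + ‖w‖ ^ 2) := by
  set F : Space d → Space d → ℝ≥0∞ := fun v x =>
    ENNReal.ofReal (gaussianDensity μ σ x * ‖c • (x - μ) + v‖ ^ 2) with hF
  -- Averaging over the reflection of space in `μ` removes the cross term.
  have hrefl : ∫⁻ x, F w x = ∫⁻ x, F (-w) x := by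
    rw [← lintegral_sub_left_eq_self (F w) (μ + μ)]
    refine lintegral_congr fun x => ?_
    have e : μ + μ - x - μ = -(x - μ) := by abel
    have e' : c • -(x - μ) + w = -(c • (x - μ) + -w) := by module
    simp only [hF, gaussianDensity, e, e', norm_neg]
  have hmeas : Measurable (F w) := by
    have := continuous_gaussianDensity μ σ
    exact (ENNReal.continuous_ofReal.comp (by fun_prop)).measurable
  have hsum : ∀ x, F w x + F (-w) x =
      ENNReal.ofReal (2 * c ^ 2) * ENNReal.ofReal (‖x - μ‖ ^ 2 * gaussianDensity μ σ x) +
        ENNReal.ofReal (2 * ‖w‖ ^ 2) * ENNReal.ofReal (gaussianDensity μ σ x) := fun x => by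
    have hg := (gaussianDensity_pos μ hσ x).le
    simp only [hF]
    rw [← ENNReal.ofReal_mul (by positivity), ← ENNReal.ofReal_mul (by positivity),
      ← ENNReal.ofReal_add (by positivity) (by positivity),
      ← ENNReal.ofReal_add (by positivity) (by positivity)]
    congr 1
    have h := parallelogram_law_with_norm ℝ (c • (x - μ)) w
    rw [norm_smul, Real.norm_eq_abs] at h
    have h2 := sq_abs c
    rw [← sub_eq_add_neg]
    linear_combination gaussianDensity μ σ x * h + 2 * gaussianDensity μ σ x * ‖x - μ‖ ^ 2 * h2
  have htwo : 2 * ∫⁻ x, F w x = 2 * ENNReal.ofReal (c ^ 2 * (d * σ ^ 2) + ‖w‖ ^ 2) := by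
    have hm := (continuous_gaussianDensity μ σ).measurable.ennreal_ofReal
    rw [two_mul]
    nth_rw 2 [hrefl]
    rw [← lintegral_add_left hmeas, lintegral_congr hsum,
      lintegral_add_right _ (hm.const_mul _), lintegral_const_mul' _ _ ENNReal.ofReal_ne_top,
      lintegral_const_mul' _ _ ENNReal.ofReal_ne_top, lintegral_gaussianDensity μ hσ,
      lintegral_norm_sq_mul_gaussianDensity hd μ hσ, mul_one,
      ← ENNReal.ofReal_mul (by positivity), ← ENNReal.ofReal_add (by positivity) (by positivity),
      mul_assoc, ← mul_add, ENNReal.ofReal_mul zero_le_two, ENNReal.ofReal_ofNat]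
  exact (ENNReal.mul_right_inj two_ne_zero ENNReal.ofNat_ne_top).1 htwo

/-- The Bhattacharyya overlap of two Gaussians of equal variance. -/
theorem lintegral_sqrt_gaussianDensity_mul (μ ν : Space d) {σ : ℝ} (hσ : 0 < σ) :
    ∫⁻ x, ENNReal.ofReal (√(gaussianDensity μ σ x * gaussianDensity ν σ x)) =
      ENNReal.ofReal (Real.exp (-‖μ - ν‖ ^ 2 / (8 * σ ^ 2))) := by
  simp_rw [sqrt_gaussianDensity_mul μ ν hσ, ENNReal.ofReal_mul (Real.exp_pos _).le]
  rw [lintegral_const_mul' _ _ ENNReal.ofReal_ne_top, lintegral_gaussianDensity _ hσ, mul_one]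

end Gaussian

/-! ### The marginal path of finitely many data points -/

section Path
variable {n d : ℕ}

theorem integral_dataMeasure {E : Type*} [NormedAddCommGroup E] [NormedSpace ℝ E] [CompleteSpace E]
    (x : Fin n → Space d) (f : Space d → E) :
    ∫ y, f y ∂dataMeasure x = (n : ℝ)⁻¹ • ∑ i, f (x i) := by
  rw [dataMeasure, integral_smul_measure, integral_finsetSum_measure]
  · simp
  · intro i _
    exact integrable_dirac (by simp)

theorem IsNormalizedData.ne_zero {x : Fin n → Space d} (hx : IsNormalizedData x) :
    n ≠ 0 ∧ d ≠ 0 := by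
  have h := hx.2
  constructor <;> rintro rfl <;> simp at h

theorem IsNormalizedData.sum_norm_sq {x : Fin n → Space d} (hx : IsNormalizedData x) :
    ∑ i, ‖x i‖ ^ 2 = d * n := by
  have h := hx.2
  have hn : (n : ℝ) ≠ 0 := by exact_mod_cast hx.ne_zero.1
  have hd : (d : ℝ) ≠ 0 := by exact_mod_cast hx.ne_zero.2
  field_simp at h
  linarith

variable (x : Fin n → Space d) (a m : ℝ → ℝ) {t : ℝ}

theorem pathDensity_dataMeasure (y : Space d) :
    pathDensity (dataMeasure x) a m t y = (n : ℝ)⁻¹ * ∑ i, condDensity a m t (x i) y := by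
  rw [pathDensity, integral_dataMeasure, smul_eq_mul]

theorem pathField_dataMeasure (hn : n ≠ 0) (y : Space d) :
    pathField (dataMeasure x) a m t y =
      ∑ i, (condDensity a m t (x i) y / ∑ k, condDensity a m t (x k) y) •
        condField a m t (x i) y := by
  have hn' : (n : ℝ) ≠ 0 := by exact_mod_cast hn
  rw [pathField, integral_dataMeasure, pathDensity_dataMeasure, Finset.smul_sum]
  refine Finset.sum_congr rfl fun i _ => ?_
  rw [smul_smul]
  congr 1
  rw [← div_div, div_inv_eq_mul]
  field_simp

theorem condDensity_pos (hm : 0 < m t) (x₁ y : Space d) : 0 < condDensity a m t x₁ y :=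
  gaussianDensity_pos _ hm _

theorem sum_condDensity_pos (hn : n ≠ 0) (hm : 0 < m t) (y : Space d) :
    0 < ∑ i, condDensity a m t (x i) y := by
  have : Nonempty (Fin n) := ⟨⟨0, Nat.pos_of_ne_zero hn⟩⟩
  exact Finset.sum_pos (fun i _ => condDensity_pos a m hm (x i) y) Finset.univ_nonempty

theorem continuous_condDensity (x₁ : Space d) : Continuous (condDensity a m t x₁) :=
  continuous_gaussianDensity _ _

theorem continuous_condField (x₁ : Space d) : Continuous (condField a m t x₁) := by
  unfold condField; fun_prop

theorem condField_sub (x₁ x₂ y : Space d) :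
    condField a m t x₁ y - condField a m t x₂ y =
      (deriv a t - a t * (deriv m t / m t)) • (x₁ - x₂) := by
  simp only [condField]; module

/-- Along the conditional flow a Gaussian sample `a x₁ + m z` moves with velocity `a' x₁ + m' z`, whose
mean square is `a'² ‖x₁‖² + d m'²`. -/
theorem lintegral_condDensity_mul_condField (hd : d ≠ 0) (hm : 0 < m t) (x₁ : Space d) :
    ∫⁻ y, ENNReal.ofReal (condDensity a m t x₁ y * ‖condField a m t x₁ y‖ ^ 2) =
      ENNReal.ofReal (d * deriv m t ^ 2 + deriv a t ^ 2 * ‖x₁‖ ^ 2) := by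
  have e : ∀ y, condField a m t x₁ y =
      (deriv m t / m t) • (y - a t • x₁) + deriv a t • x₁ := fun y => by
    simp only [condField]; module
  simp_rw [e, condDensity]
  rw [lintegral_gaussianDensity_mul_norm_sq hd _ _ _ hm, norm_smul, mul_pow, Real.norm_eq_abs,
    sq_abs]
  congr 1; field_simp

/-- For normalized data the conditional kinetic energy at a fixed time does not depend on the points. -/
theorem lintegral_mean_condDensity_mul_condField (hx : IsNormalizedData x) (hm : 0 < m t) :
    ∫⁻ y, ENNReal.ofReal
        ((n : ℝ)⁻¹ * ∑ i, condDensity a m t (x i) y * ‖condField a m t (x i) y‖ ^ 2) =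
      ENNReal.ofReal (d * (deriv a t ^ 2 + deriv m t ^ 2)) := by
  have hn' : (n : ℝ) ≠ 0 := by exact_mod_cast hx.ne_zero.1
  have hpos : ∀ i y, 0 ≤ condDensity a m t (x i) y * ‖condField a m t (x i) y‖ ^ 2 := fun i y =>
    mul_nonneg (condDensity_pos a m hm _ _).le (sq_nonneg _)
  have hmeas : ∀ i, Measurable fun y =>
      ENNReal.ofReal (condDensity a m t (x i) y * ‖condField a m t (x i) y‖ ^ 2) := fun i => by
    have h1 := continuous_condDensity a m (t := t) (x i)
    have h2 := continuous_condField a m (t := t) (x i)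
    exact (ENNReal.continuous_ofReal.comp (by fun_prop)).measurable
  simp_rw [ENNReal.ofReal_mul (inv_nonneg.2 (Nat.cast_nonneg n)),
    ENNReal.ofReal_sum_of_nonneg fun i _ => hpos i _]
  rw [lintegral_const_mul' _ _ ENNReal.ofReal_ne_top, lintegral_finsetSum _ fun i _ => hmeas i]
  simp_rw [lintegral_condDensity_mul_condField a m hx.ne_zero.2 hm]
  rw [← ENNReal.ofReal_sum_of_nonneg fun i _ => by positivity, ← ENNReal.ofReal_mul (by positivity)]
  congr 1
  simp only [Finset.sum_add_distrib, ← Finset.mul_sum, hx.sum_norm_sq, Finset.sum_const,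
    Finset.card_univ, Fintype.card_fin, nsmul_eq_mul]
  field_simp; ring

/-- The marginal kinetic energy at a fixed time is at most the conditional one. -/
theorem lintegral_pathField_le (hx : IsNormalizedData x) (hm : 0 < m t) :
    ∫⁻ y, ENNReal.ofReal (‖pathField (dataMeasure x) a m t y‖ ^ 2 *
        pathDensity (dataMeasure x) a m t y) ≤
      ENNReal.ofReal (d * (deriv a t ^ 2 + deriv m t ^ 2)) := by
  rw [← lintegral_mean_condDensity_mul_condField x a m hx hm]
  refine lintegral_mono fun y => ENNReal.ofReal_le_ofReal ?_
  rw [pathDensity_dataMeasure, pathField_dataMeasure x a m hx.ne_zero.1, mul_left_comm,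
    mul_comm (_ ^ 2)]
  exact mul_le_mul_of_nonneg_left (sum_mul_norm_sq_mean_le (fun i => condDensity_pos a m hm _ _)
    (sum_condDensity_pos x a m hx.ne_zero.1 hm y) _) (by positivity)

/-- At a fixed time the conditional kinetic energy exceeds the marginal one by at most a sum over pairs
of points, which decays like a Gaussian in the ratio `a / m`. -/
theorem le_lintegral_pathField_add (hx : IsNormalizedData x) (hm : 0 < m t) :
    ENNReal.ofReal (d * (deriv a t ^ 2 + deriv m t ^ 2)) ≤
      (∫⁻ y, ENNReal.ofReal (‖pathField (dataMeasure x) a m t y‖ ^ 2 *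
        pathDensity (dataMeasure x) a m t y)) +
      ENNReal.ofReal ((2 * n : ℝ)⁻¹ * (deriv a t - a t * (deriv m t / m t)) ^ 2 *
        ∑ i, ∑ j, ‖x i - x j‖ ^ 2 * Real.exp (-(‖x i - x j‖ ^ 2 / 8) * (a t / m t) ^ 2)) := by
  set β := deriv a t - a t * (deriv m t / m t)
  have hs : ∀ i j, ∫⁻ y, ENNReal.ofReal (√(condDensity a m t (x i) y * condDensity a m t (x j) y)) =
      ENNReal.ofReal (Real.exp (-(‖x i - x j‖ ^ 2 / 8) * (a t / m t) ^ 2)) := fun i j => by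
    simp only [condDensity]
    rw [lintegral_sqrt_gaussianDensity_mul _ _ hm, ← smul_sub, norm_smul, mul_pow, Real.norm_eq_abs,
      sq_abs]
    congr 2; field_simp
  have hmeas : ∀ i j, Measurable fun y => ENNReal.ofReal (‖x i - x j‖ ^ 2) *
      ENNReal.ofReal (√(condDensity a m t (x i) y * condDensity a m t (x j) y)) := fun i j => by
    have h1 := fun i => continuous_condDensity a m (t := t) (x i)
    exact (ENNReal.continuous_ofReal.comp (by fun_prop)).measurable.const_mul _
  have herr : ∫⁻ y, ENNReal.ofReal ((2 * n : ℝ)⁻¹ * β ^ 2 * ∑ i, ∑ j, ‖x i - x j‖ ^ 2 *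
      √(condDensity a m t (x i) y * condDensity a m t (x j) y)) =
      ENNReal.ofReal ((2 * n : ℝ)⁻¹ * β ^ 2 *
        ∑ i, ∑ j, ‖x i - x j‖ ^ 2 * Real.exp (-(‖x i - x j‖ ^ 2 / 8) * (a t / m t) ^ 2)) := by
    have hc : (0 : ℝ) ≤ (2 * n : ℝ)⁻¹ * β ^ 2 := by positivity
    have hsplit : ∀ f : Fin n → Fin n → ℝ, (∀ i j, 0 ≤ f i j) →
        ENNReal.ofReal (∑ i, ∑ j, ‖x i - x j‖ ^ 2 * f i j) =
          ∑ i, ∑ j, ENNReal.ofReal (‖x i - x j‖ ^ 2) * ENNReal.ofReal (f i j) := fun f hf => by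
      have h0 : ∀ i j, 0 ≤ ‖x i - x j‖ ^ 2 * f i j := fun i j => mul_nonneg (sq_nonneg _) (hf i j)
      rw [ENNReal.ofReal_sum_of_nonneg fun i _ => Finset.sum_nonneg fun j _ => h0 i j]
      refine Finset.sum_congr rfl fun i _ => ?_
      rw [ENNReal.ofReal_sum_of_nonneg fun j _ => h0 i j]
      exact Finset.sum_congr rfl fun j _ => ENNReal.ofReal_mul (sq_nonneg _)
    simp_rw [ENNReal.ofReal_mul hc]
    rw [hsplit _ fun i j => (Real.exp_pos _).le, lintegral_const_mul' _ _ ENNReal.ofReal_ne_top]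
    simp_rw [hsplit _ fun i j => Real.sqrt_nonneg _]
    rw [lintegral_finsetSum _ fun i _ => Finset.measurable_sum _ fun j _ => hmeas i j]
    simp_rw [lintegral_finsetSum _ fun j _ => hmeas _ j,
      lintegral_const_mul' _ _ ENNReal.ofReal_ne_top, hs]
  rw [← herr, ← lintegral_mean_condDensity_mul_condField x a m hx hm, ← lintegral_add_right]
  · refine lintegral_mono fun y => ?_
    have hS := sum_condDensity_pos x a m hx.ne_zero.1 hm y
    have hp : 0 ≤ pathDensity (dataMeasure x) a m t y := by
      rw [pathDensity_dataMeasure]; positivity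
    rw [← ENNReal.ofReal_add (by positivity) (by positivity)]
    refine ENNReal.ofReal_le_ofReal ?_
    rw [pathDensity_dataMeasure, pathField_dataMeasure x a m hx.ne_zero.1]
    have h := mul_le_mul_of_nonneg_left (le_sum_mul_norm_sq_mean_add
      (fun i => condDensity_pos a m hm (x i) y) hS fun i => condField a m t (x i) y)
      (by positivity : (0 : ℝ) ≤ (n : ℝ)⁻¹)
    simp_rw [condField_sub, norm_smul, mul_pow, Real.norm_eq_abs, sq_abs] at h
    refine h.trans_eq ?_
    have e : ∑ i, ∑ j, √(condDensity a m t (x i) y * condDensity a m t (x j) y) *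
        (β ^ 2 * ‖x i - x j‖ ^ 2) = β ^ 2 * ∑ i, ∑ j, ‖x i - x j‖ ^ 2 *
        √(condDensity a m t (x i) y * condDensity a m t (x j) y) := by
      simp only [Finset.mul_sum]
      refine Finset.sum_congr rfl fun i _ => Finset.sum_congr rfl fun j _ => ?_
      ring
    rw [e, mul_inv]; ring
  · have h1 := fun i => continuous_condDensity a m (t := t) (x i)
    exact (ENNReal.continuous_ofReal.comp (by fun_prop)).measurable

end Path

/-! ### Integration over time -/

section Time

theorem lintegral_sq_mul_exp_neg_sq {D : ℝ} (hD : 0 ≤ D) :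
    ∫⁻ s : ℝ, ENNReal.ofReal (D ^ 2 * Real.exp (-(D ^ 2 / 8) * s ^ 2)) =
      ENNReal.ofReal (√(8 * Real.pi) * D) := by
  rcases hD.eq_or_lt with rfl | hD
  · simp
  rw [← ofReal_integral_eq_lintegral_ofReal
    ((integrable_exp_neg_mul_sq (by positivity)).const_mul _) (.of_forall fun s => by positivity),
    integral_const_mul, integral_gaussian]
  congr 1
  have : Real.pi / (D ^ 2 / 8) = 8 * Real.pi / D ^ 2 := by field_simp
  rw [this, Real.sqrt_div (by positivity), Real.sqrt_sq hD.le]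
  field_simp

/-- A function on `[0,1]` with increment `±1` has Dirichlet energy at least `1`; the bound `M` on the
derivative serves to make it integrable. -/
theorem one_le_integral_deriv_sq {f : ℝ → ℝ} {M : ℝ} (hf : ContinuousOn f (Set.Icc 0 1))
    (hf' : ∀ t ∈ Set.Ioo (0 : ℝ) 1, DifferentiableAt ℝ f t)
    (hM : ∀ t ∈ Set.Ioo (0 : ℝ) 1, |deriv f t| ≤ M) (hends : |f 1 - f 0| = 1) :
    IntegrableOn (fun t => deriv f t ^ 2) (Set.Ioo 0 1) ∧
      1 ≤ ∫ t in Set.Ioo (0 : ℝ) 1, deriv f t ^ 2 := by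
  have hint : IntegrableOn (deriv f) (Set.Ioo 0 1) :=
    Measure.integrableOn_of_bounded (M := M) (by simp) (measurable_deriv f).aestronglyMeasurable
      ((ae_restrict_iff' measurableSet_Ioo).2 (.of_forall hM))
  have hint2 : IntegrableOn (fun t => deriv f t ^ 2) (Set.Ioo 0 1) :=
    Measure.integrableOn_of_bounded (M := M ^ 2) (by simp)
      ((measurable_deriv f).pow_const 2).aestronglyMeasurable
      ((ae_restrict_iff' measurableSet_Ioo).2 (.of_forall fun t ht => by
        rw [norm_pow]; exact pow_le_pow_left₀ (norm_nonneg _) (hM t ht) 2))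
  refine ⟨hint2, ?_⟩
  have hFTC : ∫ t in Set.Ioo (0 : ℝ) 1, deriv f t = f 1 - f 0 := by
    rw [← integral_Ioc_eq_integral_Ioo, ← intervalIntegral.integral_of_le zero_le_one]
    exact intervalIntegral.integral_eq_sub_of_hasDerivAt_of_le zero_le_one hf
      (fun t ht => (hf' t ht).hasDerivAt)
      ((intervalIntegrable_iff_integrableOn_Ioo_of_le zero_le_one).2 hint)
  set c := f 1 - f 0
  have hc : c ^ 2 = 1 := by rw [← sq_abs, hends, one_pow]
  -- Integrate `(f' - c)² ≥ 0`, where `c = ±1` is the slope of the affine function.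
  calc (1 : ℝ) = ∫ t in Set.Ioo (0 : ℝ) 1, (2 * c * deriv f t - 1) := by
        rw [integral_sub (hint.const_mul _) (by simp), integral_const_mul, hFTC]
        simp
        linarith
    _ ≤ _ := integral_mono ((hint.const_mul _).sub (by simp)) hint2 fun t => by
        show 2 * c * deriv f t - 1 ≤ deriv f t ^ 2
        nlinarith [sq_nonneg (deriv f t - c)]

variable {a m : ℝ → ℝ} {M t : ℝ}

theorem IsAffineConditional.differentiableAt (h : IsAffineConditional a m)
    (ht : t ∈ Set.Ioo (0 : ℝ) 1) : DifferentiableAt ℝ a t ∧ DifferentiableAt ℝ m t :=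
  ⟨(h.a_smooth.contDiffAt (isOpen_Ioo.mem_nhds ht)).differentiableAt (by simp),
    (h.m_smooth.contDiffAt (isOpen_Ioo.mem_nhds ht)).differentiableAt (by simp)⟩

theorem mem_conditionalFamily : (a, m) ∈ conditionalFamily M ↔ IsAffineConditional a m ∧
    StrictMonoOn (fun t => a t / m t) (Set.Ico 0 1) ∧ SobolevBound a M ∧ SobolevBound m M :=
  Iff.rfl

/-- If `m t = 0` with `0 < t < 1`, then `a t / m t` has the junk value `0 = a 0 / m 0`, against strict
monotonicity. -/
theorem scale_pos_of_mem_conditionalFamily (h : (a, m) ∈ conditionalFamily M)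
    (ht : t ∈ Set.Ioo (0 : ℝ) 1) : 0 < m t := by
  obtain ⟨hac, hmono, -, -⟩ := mem_conditionalFamily.1 h
  refine (hac.m_nonneg t ⟨ht.1.le, ht.2.le⟩).lt_of_ne' fun h0 => ?_
  have := hmono ⟨le_rfl, one_pos⟩ ⟨ht.1.le, ht.2⟩ ht.1
  simp [h0, hac.a_zero] at this

/-- With `r = a / m` the coefficient `β = a' - a m' / m` equals `m r'`, so `β² = (m² r') r'`, and
`m² r' = a' m - a m'` is bounded by `2 M²`. -/
theorem sq_condField_coeff_le (h : (a, m) ∈ conditionalFamily M) (ht : t ∈ Set.Ioo (0 : ℝ) 1) :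
    (deriv a t - a t * (deriv m t / m t)) ^ 2 ≤ 2 * M ^ 2 * |deriv (fun s => a s / m s) t| := by
  have hm := scale_pos_of_mem_conditionalFamily h ht
  obtain ⟨hac, -, ha, hm'⟩ := mem_conditionalFamily.1 h
  obtain ⟨hda, hdm⟩ := hac.differentiableAt ht
  have ht' : t ∈ Set.Icc (0 : ℝ) 1 := ⟨ht.1.le, ht.2.le⟩
  have hr : deriv (fun s => a s / m s) t = (deriv a t * m t - a t * deriv m t) / m t ^ 2 :=
    deriv_fun_div hda hdm hm.ne'
  set w := deriv a t * m t - a t * deriv m t with hw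
  have hwM : |w| ≤ 2 * M ^ 2 := by
    have hM : 0 ≤ M := (abs_nonneg _).trans (ha.1 t ht')
    calc |w| ≤ |deriv a t| * |m t| + |a t| * |deriv m t| := by
          rw [← abs_mul, ← abs_mul]; exact abs_sub _ _
      _ ≤ M * M + M * M := add_le_add
          (mul_le_mul (ha.2 t ht) (hm'.1 t ht') (abs_nonneg _) hM)
          (mul_le_mul (ha.1 t ht') (hm'.2 t ht) (abs_nonneg _) hM)
      _ = _ := by ring
  have e : (deriv a t - a t * (deriv m t / m t)) ^ 2 = |w| * |w / m t ^ 2| := by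
    rw [abs_div, abs_of_pos (pow_pos hm 2), ← mul_div_assoc |w|, abs_mul_abs_self, hw]
    field_simp
  rw [e, hr]
  exact mul_le_mul_of_nonneg_right hwM (abs_nonneg _)

/-- The substitution `s = a / m`, which is injective on `(0,1)` by strict monotonicity. -/
theorem lintegral_deriv_ratio_mul_le (h : (a, m) ∈ conditionalFamily M) (g : ℝ → ℝ≥0∞) :
    ∫⁻ t in Set.Ioo (0 : ℝ) 1, ENNReal.ofReal |deriv (fun s => a s / m s) t| * g (a t / m t) ≤
      ∫⁻ s, g s := by
  rw [← lintegral_image_eq_lintegral_abs_deriv_mul (f := fun s => a s / m s) measurableSet_Ioo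
    (fun t ht => ?_) (h.2.1.injOn.mono Set.Ioo_subset_Ico_self)]
  · exact setLIntegral_le_lintegral _ _
  · obtain ⟨hda, hdm⟩ := h.1.differentiableAt ht
    exact (hda.fun_div hdm
      (scale_pos_of_mem_conditionalFamily h ht).ne').hasDerivAt.hasDerivWithinAt

theorem two_le_lintegral_conditional (d : ℕ) (h : (a, m) ∈ conditionalFamily M) :
    ENNReal.ofReal (d * 2) ≤
      ∫⁻ t in Set.Ioo (0 : ℝ) 1, ENNReal.ofReal (d * (deriv a t ^ 2 + deriv m t ^ 2)) := by
  obtain ⟨hac, -, ha, hm⟩ := mem_conditionalFamily.1 h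
  obtain ⟨ha1, ha2⟩ := one_le_integral_deriv_sq hac.a_cont
    (fun t ht => (hac.differentiableAt ht).1) ha.2 (by simp [hac.a_one, hac.a_zero])
  obtain ⟨hm1, hm2⟩ := one_le_integral_deriv_sq hac.m_cont
    (fun t ht => (hac.differentiableAt ht).2) hm.2 (by simp [hac.m_one, hac.m_zero])
  have hint : IntegrableOn (fun t => (d : ℝ) * (deriv a t ^ 2 + deriv m t ^ 2)) (Set.Ioo 0 1) :=
    (ha1.add hm1).const_mul _
  rw [← ofReal_integral_eq_lintegral_ofReal hint (.of_forall fun t => by positivity),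
    integral_const_mul, integral_add ha1 hm1]
  exact ENNReal.ofReal_le_ofReal (mul_le_mul_of_nonneg_left (by linarith) (Nat.cast_nonneg d))

end Time

/-! ### Kinetic energies -/

section Energy
variable {n d : ℕ} {x : Fin n → Space d} {a m : ℝ → ℝ} {M : ℝ}

/-- The total error in terms of `n / √d`; the constant is `√(16 π) ≤ 8`. -/
theorem sum_sum_sqrt_mul_norm_sub_le (hx : IsNormalizedData x) (M : ℝ) :
    M ^ 2 / n * ∑ i, ∑ j, √(8 * Real.pi) * ‖x i - x j‖ ≤ d * (8 * M ^ 2 * (n / √d)) := by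
  have hn : (0 : ℝ) < n := by exact_mod_cast Nat.pos_of_ne_zero hx.ne_zero.1
  have hd : (0 : ℝ) < d := by exact_mod_cast Nat.pos_of_ne_zero hx.ne_zero.2
  have hsd : (d : ℝ) = √d * √d := (Real.mul_self_sqrt hd.le).symm
  have hsd0 : 0 < √(d : ℝ) := Real.sqrt_pos.2 hd
  have hroot : √(2 * n * ∑ i, ‖x i‖ ^ 2) = n * (√2 * √d) := by
    rw [hx.sum_norm_sq, ← Real.sqrt_mul zero_le_two, ← Real.sqrt_sq hn.le,
      ← Real.sqrt_mul (sq_nonneg _)]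
    congr 1
    rw [Real.sqrt_sq hn.le]; ring
  have hpi : √(8 * Real.pi) * √2 ≤ 8 := by
    rw [← Real.sqrt_mul (by positivity)]
    exact Real.sqrt_le_iff.2 ⟨by norm_num, by nlinarith [Real.pi_le_four]⟩
  have hD := sum_sum_norm_sub_le x
  rw [hroot] at hD
  simp only [← Finset.mul_sum]
  calc M ^ 2 / n * (√(8 * Real.pi) * ∑ i, ∑ j, ‖x i - x j‖)
      ≤ M ^ 2 / n * (√(8 * Real.pi) * (n * (n * (√2 * √d)))) := by gcongr
    _ = M ^ 2 * n * √d * (√(8 * Real.pi) * √2) := by field_simp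
    _ ≤ M ^ 2 * n * √d * 8 := by gcongr
    _ = √d * √d * (8 * M ^ 2 * (n / √d)) := by field_simp
    _ = _ := by rw [← hsd]

theorem aemeasurable_comp_ratio (h : (a, m) ∈ conditionalFamily M) {g : ℝ → ℝ≥0∞}
    (hg : Measurable g) :
    AEMeasurable (fun t => ENNReal.ofReal |deriv (fun s => a s / m s) t| * g (a t / m t))
      (volume.restrict (Set.Ioo 0 1)) := by
  have hac := (mem_conditionalFamily.1 h).1
  have hr : ContinuousOn (fun t => a t / m t) (Set.Ioo 0 1) :=
    (hac.a_cont.mono Set.Ioo_subset_Icc_self).div (hac.m_cont.mono Set.Ioo_subset_Icc_self)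
      fun t ht => (scale_pos_of_mem_conditionalFamily h ht).ne'
  have hd : Measurable fun t => ENNReal.ofReal |deriv (fun s => a s / m s) t| :=
    (continuous_abs.measurable.comp (measurable_deriv _)).ennreal_ofReal
  exact hd.aemeasurable.mul (hg.comp_aemeasurable (hr.aemeasurable measurableSet_Ioo))

/-- Every admissible pair has energy at least `2`, the energy of the conditional Cond-OT flow, up to an
error of order `n / √d`. -/
theorem two_le_kineticEnergy_add (hx : IsNormalizedData x) (h : (a, m) ∈ conditionalFamily M) :
    2 ≤ kineticEnergy (dataMeasure x) a m + ENNReal.ofReal (8 * M ^ 2 * (n / √d)) := by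
  have hn : (0 : ℝ) < n := by exact_mod_cast Nat.pos_of_ne_zero hx.ne_zero.1
  have hd : (d : ℝ≥0∞) ≠ 0 := by exact_mod_cast hx.ne_zero.2
  set r' : ℝ → ℝ := deriv fun s => a s / m s
  set g : Fin n → Fin n → ℝ → ℝ≥0∞ := fun i j s =>
    ENNReal.ofReal (‖x i - x j‖ ^ 2 * Real.exp (-(‖x i - x j‖ ^ 2 / 8) * s ^ 2))
  have hgm : ∀ i j, Measurable (g i j) := fun i j =>
    (ENNReal.continuous_ofReal.comp (by fun_prop)).measurable
  -- `K t` bounds the posterior variance at time `t`.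
  set K : ℝ → ℝ≥0∞ := fun t => ENNReal.ofReal (M ^ 2 / n) *
    ∑ i, ∑ j, ENNReal.ofReal |r' t| * g i j (a t / m t) with hK
  have hmeas := fun i j => aemeasurable_comp_ratio h (hgm i j)
  have hKm : AEMeasurable K (volume.restrict (Set.Ioo 0 1)) :=
    (Finset.aemeasurable_fun_sum _ fun i _ =>
      Finset.aemeasurable_fun_sum _ fun j _ => hmeas i j).const_mul _
  have hKint : ∫⁻ t in Set.Ioo (0 : ℝ) 1, K t ≤ d * ENNReal.ofReal (8 * M ^ 2 * (n / √d)) := by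
    rw [lintegral_const_mul' _ _ ENNReal.ofReal_ne_top, lintegral_finsetSum' _ fun i _ =>
      Finset.aemeasurable_fun_sum _ fun j _ => hmeas i j]
    calc _ ≤ ENNReal.ofReal (M ^ 2 / n) *
          ∑ i, ∑ j, ENNReal.ofReal (√(8 * Real.pi) * ‖x i - x j‖) := by
          gcongr with i _
          rw [lintegral_finsetSum' _ fun j _ => hmeas i j]
          gcongr with j _
          exact (lintegral_deriv_ratio_mul_le h (g i j)).trans_eq
            (lintegral_sq_mul_exp_neg_sq (norm_nonneg _))
      _ = ENNReal.ofReal (M ^ 2 / n * ∑ i, ∑ j, √(8 * Real.pi) * ‖x i - x j‖) := by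
          rw [ENNReal.ofReal_mul (by positivity),
            ENNReal.ofReal_sum_of_nonneg fun i _ => by positivity]
          congr 1
          refine Finset.sum_congr rfl fun i _ => ?_
          rw [ENNReal.ofReal_sum_of_nonneg fun j _ => by positivity]
      _ ≤ ENNReal.ofReal (d * (8 * M ^ 2 * (n / √d))) :=
          ENNReal.ofReal_le_ofReal (sum_sum_sqrt_mul_norm_sub_le hx M)
      _ = _ := by rw [ENNReal.ofReal_mul (Nat.cast_nonneg d), ENNReal.ofReal_natCast]
  have hpt : ∀ t ∈ Set.Ioo (0 : ℝ) 1, ENNReal.ofReal (d * (deriv a t ^ 2 + deriv m t ^ 2)) ≤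
      (∫⁻ y, ENNReal.ofReal (‖pathField (dataMeasure x) a m t y‖ ^ 2 *
        pathDensity (dataMeasure x) a m t y)) + K t := fun t ht => by
    refine (le_lintegral_pathField_add x a m hx
      (scale_pos_of_mem_conditionalFamily h ht)).trans ?_
    gcongr
    have hb := sq_condField_coeff_le h ht
    have hsum : ∑ i, ∑ j, ENNReal.ofReal |r' t| * g i j (a t / m t) = ENNReal.ofReal (|r' t| *
        ∑ i, ∑ j, ‖x i - x j‖ ^ 2 * Real.exp (-(‖x i - x j‖ ^ 2 / 8) * (a t / m t) ^ 2)) := by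
      simp only [← Finset.mul_sum]
      rw [ENNReal.ofReal_mul (abs_nonneg _),
        ENNReal.ofReal_sum_of_nonneg fun i _ => by positivity]
      congr 1
      refine Finset.sum_congr rfl fun i _ => ?_
      rw [ENNReal.ofReal_sum_of_nonneg fun j _ => by positivity]
    simp only [hK]
    rw [hsum, ← ENNReal.ofReal_mul (by positivity), ← mul_assoc]
    refine ENNReal.ofReal_le_ofReal (mul_le_mul_of_nonneg_right ?_ (by positivity))
    calc _ ≤ (2 * n : ℝ)⁻¹ * (2 * M ^ 2 * |r' t|) := by gcongr
      _ = _ := by field_simp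
  have hmain : (d : ℝ≥0∞) * 2 ≤ (∫⁻ t in Set.Ioo (0 : ℝ) 1, ∫⁻ y, ENNReal.ofReal
      (‖pathField (dataMeasure x) a m t y‖ ^ 2 * pathDensity (dataMeasure x) a m t y)) +
      d * ENNReal.ofReal (8 * M ^ 2 * (n / √d)) := by
    calc (d : ℝ≥0∞) * 2 = ENNReal.ofReal (d * 2) := by
          rw [ENNReal.ofReal_mul (Nat.cast_nonneg d), ENNReal.ofReal_natCast, ENNReal.ofReal_ofNat]
      _ ≤ _ := two_le_lintegral_conditional d h
      _ ≤ _ := setLIntegral_mono' measurableSet_Ioo hpt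
      _ = _ := lintegral_add_right' _ hKm
      _ ≤ _ := by gcongr
  calc (2 : ℝ≥0∞) = (d : ℝ≥0∞)⁻¹ * (d * 2) :=
        (ENNReal.inv_mul_cancel_left hd (ENNReal.natCast_ne_top d)).symm
    _ ≤ _ := mul_le_mul_right hmain _
    _ = _ := by
        rw [mul_add, ENNReal.inv_mul_cancel_left hd (ENNReal.natCast_ne_top d), kineticEnergy]

theorem condOT_mem_conditionalFamily (hM : 1 ≤ M) : condOT ∈ conditionalFamily M := by
  refine mem_conditionalFamily.2 ⟨⟨fun t ht => ht.1, fun t ht => sub_nonneg.2 ht.2, rfl, sub_self 1,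
    rfl, sub_zero 1, by fun_prop, by fun_prop, by fun_prop, by fun_prop⟩, ?_,
    ⟨fun t ht => ?_, fun t ht => ?_⟩, ⟨fun t ht => ?_, fun t ht => ?_⟩⟩
  · intro s hs t ht hst
    have hs1 : 0 < 1 - s := sub_pos.2 hs.2
    have ht1 : 0 < 1 - t := sub_pos.2 ht.2
    show s / (1 - s) < t / (1 - t)
    rw [div_lt_div_iff₀ hs1 ht1]
    nlinarith
  · rw [abs_le]; constructor <;> linarith [ht.1, ht.2]
  · simpa using hM
  · rw [abs_le]; constructor <;> linarith [ht.1, ht.2]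
  · simpa [deriv_const_sub] using hM

theorem kineticEnergy_condOT_le (hx : IsNormalizedData x) :
    kineticEnergy (dataMeasure x) condOT.1 condOT.2 ≤ 2 := by
  have hd : (d : ℝ≥0∞) ≠ 0 := by exact_mod_cast hx.ne_zero.2
  have hpt : ∀ t ∈ Set.Ioo (0 : ℝ) 1, ∫⁻ y, ENNReal.ofReal
      (‖pathField (dataMeasure x) condOT.1 condOT.2 t y‖ ^ 2 *
        pathDensity (dataMeasure x) condOT.1 condOT.2 t y) ≤ d * 2 := fun t ht => by
    refine (lintegral_pathField_le x condOT.1 condOT.2 hx (sub_pos.2 ht.2)).trans_eq ?_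
    have h1 : deriv condOT.1 t = 1 := deriv_id t
    have h2 : deriv condOT.2 t = -1 := by simp [condOT]
    rw [h1, h2, ENNReal.ofReal_mul (Nat.cast_nonneg d), ENNReal.ofReal_natCast]
    norm_num
  calc _ ≤ (d : ℝ≥0∞)⁻¹ * ∫⁻ _ in Set.Ioo (0 : ℝ) 1, (d : ℝ≥0∞) * 2 := by
        rw [kineticEnergy]
        exact mul_le_mul_right (setLIntegral_mono' measurableSet_Ioo hpt) _
    _ = 2 := by
        rw [setLIntegral_const, Real.volume_Ioo, sub_zero, ENNReal.ofReal_one, mul_one,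
          ENNReal.inv_mul_cancel_left hd (ENNReal.natCast_ne_top d)]

end Energy

theorem corollary1 (M : ℝ) (hM : 1 ≤ M) :
    condOT ∈ conditionalFamily M ∧
    ∀ ε : ℝ, 0 < ε → ∃ δ : ℝ, 0 < δ ∧
      ∀ (n d : ℕ) (x : Fin n → Space d), IsNormalizedData x → (n : ℝ) / √(d : ℝ) < δ →
        kineticEnergy (dataMeasure x) condOT.1 condOT.2 < ⊤ ∧
        kineticEnergy (dataMeasure x) condOT.1 condOT.2 ≤
          (⨅ c ∈ conditionalFamily M, kineticEnergy (dataMeasure x) c.1 c.2) +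
            ENNReal.ofReal ε := by
  have hM0 : 0 < 8 * M ^ 2 := by positivity
  refine ⟨condOT_mem_conditionalFamily hM, fun ε hε => ⟨ε / (8 * M ^ 2), by positivity,
    fun n d x hx hnd => ⟨(kineticEnergy_condOT_le hx).trans_lt (by simp), ?_⟩⟩⟩
  refine (kineticEnergy_condOT_le hx).trans (tsub_le_iff_right.1 (le_iInf₂ fun c hc => ?_))
  rw [tsub_le_iff_right]
  refine (two_le_kineticEnergy_add hx hc).trans ?_
  gcongr
  rw [lt_div_iff₀ hM0] at hnd
  linarith
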